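/- Let $N\ge 1$ and $T$ be natural numbers, $\Omega\subseteq\{1,\dots,N\}$ with $|\Omega|=M$, $Y\in\mathbb C^{M\times T}$ (rows indexed by $\Omega$), $\gamma>0$, and let $\phi_1,\dots,\phi_K\in\mathbb C^T$ be not all zero; put $c_1=\max_k\|\phi_k\|_2/\sqrt N>0$. For matrices let $\langle A,B\rangle=\sum_{i,l}A_{il}\overline{B_{il}}$, with $\|\cdot\|_F$ the Frobenius norm. Let $\mathcal P_\Omega:\mathbb C^{N\times T}\to\mathbb C^{M\times T}$ keep the rows indexed by $\Omega$, and let $\mathcal P_\Omega^{\rm Adj}$ be its adjoint (fill the missing rows with zeros). For $v\in\mathbb C^N$ let $\mathcal T(v)$ be the $N\times N$ Toeplitz matrix with $(i,l)$ entry $v_{l-i+1}$ if $i\le l$ and $\overline{v_{i-l+1}}$ if $i>l$, and write $$\mathcal B(v,Z,W)=\begin{bmatrix}\mathcal T(v)&Z\\ Z^H&W\end{bmatrix},\qquad v\in\mathbb C^N,\ Z\in\mathbb C^{N\times T},\ W\in\mathbb C^{T\times T}.$$ Consider the goal-oriented problem $$\min_{v,Z,W,Y^\star}\ \mathrm{Re}(v_1)+\mathrm{Re}(\mathrm{tr}\,W)+\tfrac{\gamma}{2}\|Y-Y^\star\|_F^2\quad\text{s.t.}\quad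 \mathcal B(v,Z,W)\succeq0,\quad Y^\star=-2c_1\mathcal P_\Omega(Z).$$ A dual solution $V\in\mathbb C^{M\times T}$ associated with $Y^\star$ is a maximizer over $\mathbb C^{M\times T}$ of the Lagrange dual function $$g(V)=\inf\Big\{\mathrm{Re}(v_1)+\mathrm{Re}(\mathrm{tr}\,W)+\tfrac{\gamma}{2}\|Y-Y^\star\|_F^2+\mathrm{Re}\langle Y^\star+2c_1\mathcal P_\Omega(Z),V\rangle\ :\ \mathcal B(v,Z,W)\succeq 0,\ Y^\star\in\mathbb C^{M\times T}\Big\}.$$ The equivalent split problem minimizes $\mathrm{Re}(v_1)+\mathrm{Re}(\mathrm{tr}\,W)+\frac{\gamma}{2}\|Y+2c_1\mathcal P_\Omega(Z)\|_F^2$ subject to $\mathcal B(v,Z,W)=\Psi$ and $\Psi\succeq0$. For a Hermitian multiplier $\Lambda=\begin{bmatrix}\Lambda_0&\Lambda_1\\ \Lambda_1^H&\overline\Lambda\end{bmatrix}$, with $\Lambda_1\in\mathbb C^{N\times T}$, its augmented Lagrangian is, for $\rho\ge0$, $$\mathcal L_\rho(v,W,Z,\Lambda,\Psi)=\mathrm{Re}(v_1)+\mathrm{Re}(\mathrm{tr}\,W)+\tfrac{\gamma}{2}\|Y+2c_1\mathcal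 P_\Omega(Z)\|_F^2+\mathrm{Re}\langle\Lambda,\Psi-\mathcal B(v,Z,W)\rangle+\tfrac{\rho}{2}\|\Psi-\mathcal B(v,Z,W)\|_F^2.$$ A Hermitian $\Lambda$ is an optimal Lagrange multiplier if it maximizes the dual function $\inf\{\mathcal L_0(v,W,Z,\Lambda,\Psi): v,W,Z\text{ arbitrary},\ \Psi\succeq0\}$ among Hermitian matrices. ADMM with parameter $\rho>0$, started at Hermitian $\Psi^0,\Lambda^0$ (for instance both zero), generates $$(v^{t+1},W^{t+1},Z^{t+1})\in\mathop{\arg\min}_{v,W,Z}\mathcal L_\rho(v,W,Z,\Lambda^t,\Psi^t),\qquad \Psi^{t+1}\in\mathop{\arg\min}_{\Psi\succeq0}\mathcal L_\rho(v^{t+1},W^{t+1},Z^{t+1},\Lambda^t,\Psi),$$ $$\Lambda^{t+1}=\Lambda^t+\rho\big(\Psi^{t+1}-\mathcal B(v^{t+1},Z^{t+1},W^{t+1})\big).$$ **Lemma.** There is exactly one dual solution $V$ associated with $Y^\star$, and there is an optimal Lagrange multiplier of the split problem. For the dual solution $V$: 1. every optimal Lagrange multiplier $\Lambda$ of the split problem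 satisfies $\mathcal P_\Omega^{\rm Adj}(V)=\Lambda_1/c_1$; 2. for every $\rho>0$ and every sequence of ADMM iterates as above, the off-diagonal blocks $\Lambda_1^t$ of $\Lambda^t$ converge, and $\mathcal P_\Omega^{\rm Adj}(V)=\lim_{t\to\infty}\Lambda_1^t/c_1$. -/

import Mathlib

open Matrix Filter Topology
open scoped ComplexOrder ComplexConjugate

noncomputable section

namespace GoalOriented

variable {N T : ℕ}

/-- The inner product `⟨A, B⟩ = ∑ i l, A i l * conj (B i l)` of complex matrices. -/
def cinner {m n : Type*} [Fintype m] [Fintype n] (A B : Matrix m n ℂ) : ℂ :=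
  ∑ i, ∑ l, A i l * conj (B i l)

/-- The squared Frobenius norm. -/
def frobSq {m n : Type*} [Fintype m] [Fintype n] (A : Matrix m n ℂ) : ℝ :=
  ∑ i, ∑ l, ‖A i l‖ ^ 2

/-- The Toeplitz matrix with first row `v` and first column `v 0, conj (v 1), conj (v 2), …`. -/
def toeplitz (v : Fin N → ℂ) : Matrix (Fin N) (Fin N) ℂ :=
  Matrix.of fun i l =>
    if i ≤ l then v ⟨l.val - i.val, lt_of_le_of_lt (Nat.sub_le _ _) l.isLt⟩
    else conj (v ⟨i.val - l.val, lt_of_le_of_lt (Nat.sub_le _ _) i.isLt⟩)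

/-- Restriction of a matrix to the rows indexed by `Ω`. -/
def restrictRows (Ω : Finset (Fin N)) (Z : Matrix (Fin N) (Fin T) ℂ) : Matrix Ω (Fin T) ℂ :=
  Matrix.of fun i l => Z i.val l

/-- The adjoint of `restrictRows Ω`: rows in `Ω` are kept, all the others are zero. -/
def restrictRowsAdj (Ω : Finset (Fin N)) (V : Matrix Ω (Fin T) ℂ) : Matrix (Fin N) (Fin T) ℂ :=
  Matrix.of fun i l => if h : i ∈ Ω then V ⟨i, h⟩ l else 0

/-- The constant `c₁ = max_k ‖φ_k‖₂ / √N`. -/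
def c1 {K : ℕ} (N : ℕ) (φ : Fin K → EuclideanSpace ℂ (Fin T)) : ℝ :=
  (⨆ k, ‖φ k‖) / √(N : ℝ)

/-- The block matrix `[T(v), Z; Zᴴ, W]`. -/
def blockMat (v : Fin N → ℂ) (Z : Matrix (Fin N) (Fin T) ℂ) (W : Matrix (Fin T) (Fin T) ℂ) :
    Matrix (Fin N ⊕ Fin T) (Fin N ⊕ Fin T) ℂ :=
  Matrix.fromBlocks (toeplitz v) Z Zᴴ W

/-! The goal-oriented problem: minimize `goalObjective` over all `v, Z, W, Ys` subject to
`blockMat v Z W` being positive semidefinite and `Ys = -2 c P_Ω(Z)`. -/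

/-- The objective `Re v₁ + Re tr W + (γ / 2) ‖Y - Ys‖²`. -/
def goalObjective [NeZero N] {Ω : Finset (Fin N)} (γ : ℝ) (Y : Matrix Ω (Fin T) ℂ)
    (v : Fin N → ℂ) (W : Matrix (Fin T) (Fin T) ℂ) (Ys : Matrix Ω (Fin T) ℂ) : ℝ :=
  (v 0).re + (W.trace).re + γ / 2 * frobSq (Y - Ys)

/-- The Lagrangian of the goal-oriented problem, with multiplier `V` for the equality constraint
`Ys = -2 c P_Ω(Z)`. -/
def goalLagrangian [NeZero N] {Ω : Finset (Fin N)} (γ c : ℝ) (Y : Matrix Ω (Fin T) ℂ)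
    (v : Fin N → ℂ) (Z : Matrix (Fin N) (Fin T) ℂ) (W : Matrix (Fin T) (Fin T) ℂ)
    (Ys V : Matrix Ω (Fin T) ℂ) : ℝ :=
  goalObjective γ Y v W Ys + (cinner (Ys - (-2 * c) • restrictRows Ω Z) V).re

/-- The Lagrange dual function: the infimum of the Lagrangian over the primal variables, which
range over all values with `blockMat v Z W` positive semidefinite. -/
def goalDualFunction [NeZero N] {Ω : Finset (Fin N)} (γ c : ℝ) (Y V : Matrix Ω (Fin T) ℂ) :
    EReal :=
  ⨅ (v : Fin N → ℂ) (Z : Matrix (Fin N) (Fin T) ℂ) (W : Matrix (Fin T) (Fin T) ℂ)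
    (Ys : Matrix Ω (Fin T) ℂ) (_ : (blockMat v Z W).PosSemidef),
    ((goalLagrangian γ c Y v Z W Ys V : ℝ) : EReal)

/-- `V` is a dual solution associated with the primal variable `Ys`. -/
def IsDualSolution [NeZero N] {Ω : Finset (Fin N)} (γ c : ℝ) (Y V : Matrix Ω (Fin T) ℂ) : Prop :=
  ∀ V' : Matrix Ω (Fin T) ℂ, goalDualFunction γ c Y V' ≤ goalDualFunction γ c Y V

/-! The split problem: minimize `Re v₁ + Re tr W + (γ / 2) ‖Y + 2 c P_Ω(Z)‖²` over all
`v, Z, W, Ψ` subject to `blockMat v Z W = Ψ` and `Ψ` positive semidefinite. -/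

/-- The augmented Lagrangian `L_ρ` of the split problem; `ρ = 0` gives the Lagrangian. -/
def augLagrangian [NeZero N] {Ω : Finset (Fin N)} (γ c ρ : ℝ) (Y : Matrix Ω (Fin T) ℂ)
    (v : Fin N → ℂ) (W : Matrix (Fin T) (Fin T) ℂ) (Z : Matrix (Fin N) (Fin T) ℂ)
    (Λ Ψ : Matrix (Fin N ⊕ Fin T) (Fin N ⊕ Fin T) ℂ) : ℝ :=
  (v 0).re + (W.trace).re + γ / 2 * frobSq (Y + (2 * c) • restrictRows Ω Z)
    + (cinner Λ (Ψ - blockMat v Z W)).re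
    + ρ / 2 * frobSq (Ψ - blockMat v Z W)

/-- The Lagrange dual function of the split problem. -/
def splitDualFunction [NeZero N] {Ω : Finset (Fin N)} (γ c : ℝ) (Y : Matrix Ω (Fin T) ℂ)
    (Λ : Matrix (Fin N ⊕ Fin T) (Fin N ⊕ Fin T) ℂ) : EReal :=
  ⨅ (v : Fin N → ℂ) (W : Matrix (Fin T) (Fin T) ℂ) (Z : Matrix (Fin N) (Fin T) ℂ)
    (Ψ : Matrix (Fin N ⊕ Fin T) (Fin N ⊕ Fin T) ℂ) (_ : Ψ.PosSemidef),
    ((augLagrangian γ c 0 Y v W Z Λ Ψ : ℝ) : EReal)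

/-- `Λ` is an optimal (Hermitian) Lagrange multiplier of the split problem. -/
def IsOptimalMultiplier [NeZero N] {Ω : Finset (Fin N)} (γ c : ℝ) (Y : Matrix Ω (Fin T) ℂ)
    (Λ : Matrix (Fin N ⊕ Fin T) (Fin N ⊕ Fin T) ℂ) : Prop :=
  Λ.IsHermitian ∧ ∀ Λ' : Matrix (Fin N ⊕ Fin T) (Fin N ⊕ Fin T) ℂ, Λ'.IsHermitian →
    splitDualFunction γ c Y Λ' ≤ splitDualFunction γ c Y Λ

/-- The sequences `v, W, Z, Ψ, Λ` are the iterates of ADMM for the split problem, started at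
Hermitian `Ψ 0` and `Λ 0`. -/
structure IsADMMRun [NeZero N] {Ω : Finset (Fin N)} (γ c ρ : ℝ) (Y : Matrix Ω (Fin T) ℂ)
    (v : ℕ → Fin N → ℂ) (W : ℕ → Matrix (Fin T) (Fin T) ℂ) (Z : ℕ → Matrix (Fin N) (Fin T) ℂ)
    (Ψ Λ : ℕ → Matrix (Fin N ⊕ Fin T) (Fin N ⊕ Fin T) ℂ) : Prop where
  init_Ψ : (Ψ 0).IsHermitian
  init_Λ : (Λ 0).IsHermitian
  step_vWZ : ∀ t v' W' Z',
    augLagrangian γ c ρ Y (v (t + 1)) (W (t + 1)) (Z (t + 1)) (Λ t) (Ψ t)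
      ≤ augLagrangian γ c ρ Y v' W' Z' (Λ t) (Ψ t)
  step_Ψ_posSemidef : ∀ t, (Ψ (t + 1)).PosSemidef
  step_Ψ : ∀ t Ψ', Ψ'.PosSemidef →
    augLagrangian γ c ρ Y (v (t + 1)) (W (t + 1)) (Z (t + 1)) (Λ t) (Ψ (t + 1))
      ≤ augLagrangian γ c ρ Y (v (t + 1)) (W (t + 1)) (Z (t + 1)) (Λ t) Ψ'
  step_Λ : ∀ t,
    Λ (t + 1) = Λ t + ρ • (Ψ (t + 1) - blockMat (v (t + 1)) (Z (t + 1)) (W (t + 1)))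

end GoalOriented

end

/-! Eliminating `Ys` leaves a convex quadratic objective on the cone of `x = (v, Z, W)` with
`blockLin x` positive semidefinite. On that cone `Re v₁` and `Re tr W` are nonnegative and control
the trace, hence every entry, so sublevel sets are compact and a minimizer `x` exists. The gradient
there is encoded by `V = γ (Y + 2 c P_Ω(Z))`: the linear form `goalForm c V` is nonnegative on the
cone and vanishes at `x`. Extending it from the range of `blockLin` to all matrices
(`IsDualFeasible.exists_isCertificate`) gives a Hermitian `Λ` in the dual of the semidefinite cone.
Since `Z` occurs twice in the block matrix, `Λ₁` must be `c P_Ω^Adj(V)`. This is the triple of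
`IsKKT`.

Where they are bounded below, both dual functions reduce to the strongly concave `dualValue γ Y V =
Re⟨Y, V⟩ - ‖V‖² / (2γ)`. On the split side, boundedness below forces `Λ` to certify `V' = c⁻¹
P_Ω(Λ₁)`. By `IsKKT.dualValue_add_le` the maximizer is unique, so every optimal `Λ` has the same
off-diagonal block.

For ADMM, the usual energy (distances of `Λ` and `Ψ` to the KKT point) decreases by at least
multiples of `‖P_Ω(Z^t - Z)‖²` and of the squared increments of `Ψ`, so both tend to zero.
Stationarity of the `(v, W, Z)` update (`IsADMMRun.toBlocks₁₂_eq`) writes `Λ₁^t` in terms of just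
these two quantities. Convergence of the full `Λ^t` or `Z^t` is never needed. -/

noncomputable section

namespace GoalOriented

variable {N T : ℕ}

/-! ### Real inner product and Frobenius norm on complex matrices -/

section InnerProduct

variable {m n : Type*} [Fintype m] [Fintype n]

/-- The real part of `cinner`, as a real bilinear form. -/
def rinner : Matrix m n ℂ →ₗ[ℝ] Matrix m n ℂ →ₗ[ℝ] ℝ :=
  LinearMap.mk₂ ℝ (fun A B => (cinner A B).re)
    (fun A A' B => by simp [cinner, add_mul, Finset.sum_add_distrib])
    (fun r A B => by simp [cinner, Finset.mul_sum, mul_assoc])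
    (fun A B B' => by simp [cinner, mul_add, Finset.sum_add_distrib])
    (fun r A B => by
      simp only [cinner, Matrix.smul_apply, Complex.real_smul, map_mul, Complex.conj_ofReal,
        Complex.re_sum, smul_eq_mul, Finset.mul_sum]
      refine Finset.sum_congr rfl fun i _ => Finset.sum_congr rfl fun j _ => ?_
      rw [mul_left_comm, Complex.re_ofReal_mul])

lemma re_cinner (A B : Matrix m n ℂ) : (cinner A B).re = rinner A B := rfl

lemma rinner_apply (A B : Matrix m n ℂ) :
    rinner A B = ∑ i, ∑ l, ((A i l).re * (B i l).re + (A i l).im * (B i l).im) := by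
  simp [← re_cinner, cinner]

lemma rinner_comm (A B : Matrix m n ℂ) : rinner A B = rinner B A := by
  simp only [rinner_apply, mul_comm]

lemma rinner_self (A : Matrix m n ℂ) : rinner A A = frobSq A := by
  simp only [rinner_apply, frobSq, Complex.sq_norm, Complex.normSq_apply]

lemma frobSq_nonneg (A : Matrix m n ℂ) : 0 ≤ frobSq A := by
  unfold frobSq; positivity

lemma norm_apply_sq_le_frobSq (A : Matrix m n ℂ) (i : m) (l : n) : ‖A i l‖ ^ 2 ≤ frobSq A :=
  (Finset.single_le_sum (f := fun l => ‖A i l‖ ^ 2) (fun _ _ => by positivity)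
    (Finset.mem_univ l)).trans
  (Finset.single_le_sum (f := fun i => ∑ l, ‖A i l‖ ^ 2) (fun _ _ => by positivity)
    (Finset.mem_univ i))

lemma frobSq_eq_zero {A : Matrix m n ℂ} : frobSq A = 0 ↔ A = 0 := by
  refine ⟨fun h => ?_, fun h => by simp [h, frobSq]⟩
  ext i l
  have := norm_apply_sq_le_frobSq A i l
  rw [h] at this
  simpa using le_antisymm this (by positivity)

lemma frobSq_add (A B : Matrix m n ℂ) :
    frobSq (A + B) = frobSq A + 2 * rinner A B + frobSq B := by
  simp only [← rinner_self, map_add, LinearMap.add_apply, rinner_comm B A]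
  ring

lemma frobSq_sub (A B : Matrix m n ℂ) :
    frobSq (A - B) = frobSq A - 2 * rinner A B + frobSq B := by
  simp only [← rinner_self, map_sub, LinearMap.sub_apply, rinner_comm B A]
  ring

lemma frobSq_smul (r : ℝ) (A : Matrix m n ℂ) : frobSq (r • A) = r ^ 2 * frobSq A := by
  simp only [← rinner_self, map_smul, LinearMap.smul_apply, smul_eq_mul]
  ring

lemma eq_of_forall_rinner_eq {A B : Matrix m n ℂ} (h : ∀ C, rinner A C = rinner B C) : A = B := by
  have h0 : rinner (A - B) (A - B) = 0 := by
    rw [map_sub rinner A B, LinearMap.sub_apply, h, sub_self]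
  rwa [rinner_self, frobSq_eq_zero, sub_eq_zero] at h0

lemma rinner_conjTranspose (A : Matrix m n ℂ) (B : Matrix n m ℂ) :
    rinner Aᴴ B = rinner A Bᴴ := by
  rw [rinner_apply, rinner_apply, Finset.sum_comm]
  simp

lemma tendsto_zero_of_frobSq {A : ℕ → Matrix m n ℂ}
    (h : Tendsto (fun t => frobSq (A t)) atTop (𝓝 0)) : Tendsto A atTop (𝓝 0) := by
  refine tendsto_pi_nhds.2 fun i => tendsto_pi_nhds.2 fun l => ?_
  rw [show (0 : Matrix m n ℂ) i l = 0 from rfl, tendsto_zero_iff_norm_tendsto_zero]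
  have h2 : Tendsto (fun t => ‖A t i l‖ ^ 2) atTop (𝓝 0) :=
    squeeze_zero (fun _ => by positivity) (fun t => norm_apply_sq_le_frobSq (A t) i l) h
  simpa using h2.sqrt

/-- Every real linear functional on complex matrices is an inner product with a matrix. -/
lemma exists_rinner_eq [DecidableEq m] [DecidableEq n] (g : Matrix m n ℂ →ₗ[ℝ] ℝ) :
    ∃ G : Matrix m n ℂ, ∀ A, g A = rinner G A := by
  -- The values of `g` on the real basis `E_il`, `I • E_il` are the real and imaginary parts of the
  -- entries.
  refine ⟨Matrix.of fun i l => ⟨g (Matrix.single i l 1), g (Matrix.single i l Complex.I)⟩,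
    fun A => ?_⟩
  conv_lhs => rw [Matrix.matrix_eq_sum_single A]
  simp only [map_sum, rinner_apply, Matrix.of_apply]
  refine Finset.sum_congr rfl fun i _ => Finset.sum_congr rfl fun l _ => ?_
  have : Matrix.single i l (A i l) = (A i l).re • Matrix.single i l (1 : ℂ)
      + (A i l).im • Matrix.single i l Complex.I := by
    rw [Matrix.smul_single, Matrix.smul_single, ← Matrix.single_add]
    congr 1
    simp [Complex.re_add_im]
  rw [this, map_add, map_smul, map_smul, smul_eq_mul, smul_eq_mul]
  ring

end InnerProduct

/-! ### Row restriction and the block Toeplitz map as real linear maps -/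

section Blocks

/-- `restrictRows` as a real linear map. -/
def restrictRowsLin (Ω : Finset (Fin N)) :
    Matrix (Fin N) (Fin T) ℂ →ₗ[ℝ] Matrix Ω (Fin T) ℂ where
  toFun := restrictRows Ω
  map_add' _ _ := rfl
  map_smul' _ _ := rfl

lemma restrictRows_eq (Ω : Finset (Fin N)) (Z : Matrix (Fin N) (Fin T) ℂ) :
    restrictRows Ω Z = restrictRowsLin Ω Z := rfl

/-- `restrictRowsAdj` as a real linear map. -/
def restrictRowsAdjLin (Ω : Finset (Fin N)) :
    Matrix Ω (Fin T) ℂ →ₗ[ℝ] Matrix (Fin N) (Fin T) ℂ where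
  toFun := restrictRowsAdj Ω
  map_add' A B := by ext i l; by_cases h : i ∈ Ω <;> simp [restrictRowsAdj, h]
  map_smul' r A := by ext i l; by_cases h : i ∈ Ω <;> simp [restrictRowsAdj, h]

lemma restrictRowsAdj_eq (Ω : Finset (Fin N)) (V : Matrix Ω (Fin T) ℂ) :
    restrictRowsAdj Ω V = restrictRowsAdjLin Ω V := rfl

lemma restrictRowsLin_apply (Ω : Finset (Fin N)) (Z : Matrix (Fin N) (Fin T) ℂ) (i : Ω)
    (l : Fin T) : restrictRowsLin Ω Z i l = Z i l := rfl

lemma restrictRowsAdjLin_apply (Ω : Finset (Fin N)) (V : Matrix Ω (Fin T) ℂ) (i : Fin N)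
    (l : Fin T) : restrictRowsAdjLin Ω V i l = if h : i ∈ Ω then V ⟨i, h⟩ l else 0 := rfl

lemma restrictRowsLin_restrictRowsAdjLin (Ω : Finset (Fin N)) (V : Matrix Ω (Fin T) ℂ) :
    restrictRowsLin Ω (restrictRowsAdjLin Ω V) = V := by
  ext i l
  simp [restrictRowsLin_apply, restrictRowsAdjLin_apply]

lemma rinner_restrictRowsAdjLin (Ω : Finset (Fin N)) (V : Matrix Ω (Fin T) ℂ)
    (Z : Matrix (Fin N) (Fin T) ℂ) :
    rinner (restrictRowsAdjLin Ω V) Z = rinner V (restrictRowsLin Ω Z) := by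
  simp only [rinner_apply]
  rw [← Finset.sum_subset (Finset.subset_univ Ω), ← Finset.sum_coe_sort Ω]
  · refine Finset.sum_congr rfl fun i _ => Finset.sum_congr rfl fun l _ => ?_
    simp [restrictRowsLin_apply, restrictRowsAdjLin_apply]
  · intro i _ hi
    simp [restrictRowsAdjLin_apply, hi]

/-- The variables `(v, Z, W)` of the semidefinite programs. -/
abbrev Vars (N T : ℕ) : Type :=
  (Fin N → ℂ) × Matrix (Fin N) (Fin T) ℂ × Matrix (Fin T) (Fin T) ℂ

/-- `blockMat` as a real linear map. -/
def blockLin : Vars N T →ₗ[ℝ] Matrix (Fin N ⊕ Fin T) (Fin N ⊕ Fin T) ℂ where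
  toFun x := blockMat x.1 x.2.1 x.2.2
  map_add' x y := by
    ext (i | i) (l | l) <;> simp [blockMat, toeplitz]
    split_ifs <;> simp
  map_smul' r x := by
    ext (i | i) (l | l) <;> simp [blockMat, toeplitz]

lemma blockMat_eq (v : Fin N → ℂ) (Z : Matrix (Fin N) (Fin T) ℂ) (W : Matrix (Fin T) (Fin T) ℂ) :
    blockMat v Z W = blockLin (v, Z, W) := rfl

lemma blockLin_inl_inl_zero [NeZero N] (x : Vars N T) (i : Fin N) :
    blockLin x (Sum.inl 0) (Sum.inl i) = x.1 i := by
  simp [blockLin, blockMat, toeplitz]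

lemma blockLin_diag [NeZero N] (x : Vars N T) (i : Fin N) :
    blockLin x (Sum.inl i) (Sum.inl i) = x.1 0 := by
  simp [blockLin, blockMat, toeplitz]

/-- `Z` and `Zᴴ` contribute equally; this 2 matches the one in `2 c P_Ω(Z)`. The hypothesis concerns
the off-diagonal blocks only, so the lemma applies to ADMM multipliers whose diagonal blocks are not
known to be Hermitian. -/
lemma rinner_blockLin_offDiag (A : Matrix (Fin N ⊕ Fin T) (Fin N ⊕ Fin T) ℂ)
    (hA : A.toBlocks₂₁ = A.toBlocks₁₂ᴴ) (Z : Matrix (Fin N) (Fin T) ℂ) :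
    rinner A (blockLin ((0, Z, 0) : Vars N T)) = 2 * rinner A.toBlocks₁₂ Z := by
  have h : rinner A.toBlocks₂₁ Zᴴ = rinner A.toBlocks₁₂ Z := by
    rw [hA, rinner_conjTranspose, conjTranspose_conjTranspose]
  rw [two_mul]
  nth_rewrite 1 [← h]
  simp only [rinner_apply, Fintype.sum_sum_type, Finset.sum_add_distrib]
  simp [blockLin, blockMat, toeplitz, toBlocks₁₂, toBlocks₂₁]
  ring

lemma trace_blockLin [NeZero N] (x : Vars N T) :
    (blockLin x).trace = N * x.1 0 + x.2.2.trace := by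
  simp only [Matrix.trace, Fintype.sum_sum_type, Matrix.diag_apply, blockLin_diag]
  simp [blockLin, blockMat]

lemma toeplitz_of_le (v : Fin N → ℂ) {i l : Fin N} (h : i ≤ l) :
    toeplitz v i l = v ⟨l.val - i.val, lt_of_le_of_lt (Nat.sub_le _ _) l.isLt⟩ := by
  simp only [toeplitz, Matrix.of_apply, if_pos h]

lemma toeplitz_of_lt (v : Fin N → ℂ) {i l : Fin N} (h : l < i) :
    toeplitz v i l = conj (v ⟨i.val - l.val, lt_of_le_of_lt (Nat.sub_le _ _) i.isLt⟩) := by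
  simp only [toeplitz, Matrix.of_apply, if_neg (not_le.2 h)]

/-- Symmetrizing `blockLin x` stays in its range. -/
lemma exists_blockLin_add_conjTranspose [NeZero N] (x : Vars N T) :
    ∃ y : Vars N T, blockLin x + (blockLin x)ᴴ = blockLin y ∧ (y.1 0).re = 2 * (x.1 0).re ∧
      y.2.1 = (2 : ℝ) • x.2.1 ∧ y.2.2.trace.re = 2 * x.2.2.trace.re := by
  obtain ⟨v, Z, W⟩ := x
  -- Off the diagonal, `T(v)` is already conjugate symmetric and just doubles; on it, `v 0` may be
  -- non-real and is replaced by twice its real part.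
  refine ⟨(fun i => if i = 0 then ((2 * (v 0).re : ℝ) : ℂ) else (2 : ℝ) • v i,
    (2 : ℝ) • Z, W + Wᴴ), ?_, ?_, rfl, ?_⟩
  · ext (i | i) (l | l)
    · rcases lt_trichotomy i l with h | h | h
      · have h2 : (⟨l.val - i.val, lt_of_le_of_lt (Nat.sub_le _ _) l.isLt⟩ : Fin N) ≠ 0 := by
          rw [Ne, Fin.ext_iff]
          exact (Nat.sub_pos_of_lt h).ne'
        change toeplitz v i l + conj (toeplitz v l i) = toeplitz _ i l
        rw [toeplitz_of_le _ h.le, toeplitz_of_lt _ h, toeplitz_of_le _ h.le, Complex.conj_conj]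
        dsimp only
        rw [if_neg h2, two_smul]
      · subst h
        apply Complex.ext <;> simp [blockLin, blockMat, toeplitz, two_mul]
      · have h2 : (⟨i.val - l.val, lt_of_le_of_lt (Nat.sub_le _ _) i.isLt⟩ : Fin N) ≠ 0 := by
          rw [Ne, Fin.ext_iff]
          exact (Nat.sub_pos_of_lt h).ne'
        change toeplitz v i l + conj (toeplitz v l i) = toeplitz _ i l
        rw [toeplitz_of_le _ h.le, toeplitz_of_lt _ h, toeplitz_of_lt _ h]
        dsimp only
        rw [if_neg h2, two_smul, map_add]
    all_goals simp [blockLin, blockMat]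
    all_goals ring
  · simp
  · simp [Matrix.trace_add, Matrix.trace_conjTranspose, two_mul]

end Blocks

/-! ### First-order conditions for affine and quadratic functions of one variable -/

section Scalar

/-- Let `s → ∞`. Used to read dual constraints off a finite lower bound for a dual function. -/
lemma nonneg_of_forall_le_add_mul {m a b : ℝ} (h : ∀ s : ℝ, 0 ≤ s → m ≤ a + s * b) : 0 ≤ b := by
  by_contra! hb
  have h0 := h 0 le_rfl
  have hs := h ((a - m + 1) / -b) (div_nonneg (by linarith) (by linarith))
  have : (a - m + 1) / -b * b = -(a - m + 1) := by
    rw [div_neg, neg_mul, div_mul_cancel₀ _ hb.ne]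
  linarith

lemma eq_zero_of_forall_le_add_mul {m a b : ℝ} (h : ∀ s : ℝ, m ≤ a + s * b) : b = 0 := by
  refine le_antisymm ?_ (nonneg_of_forall_le_add_mul fun s _ => h s)
  have := nonneg_of_forall_le_add_mul (m := m) (a := a) (b := -b) fun s _ => by
    have := h (-s)
    linarith
  linarith

/-- Divide by `s` and let `s → 0`. Used to extract variational inequalities from minimality along
segments. -/
lemma nonneg_of_forall_quadratic {b k : ℝ}
    (h : ∀ s : ℝ, 0 < s → s ≤ 1 → 0 ≤ s * b + s ^ 2 * k) : 0 ≤ b := by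
  by_contra! hb
  have hk : 0 < |k| + 1 := by positivity
  -- For this `s`, `s * |k| ≤ -b / 2`, so the linear term dominates.
  have hpos : 0 < min 1 (-b / (2 * (|k| + 1))) := lt_min one_pos (by
    apply div_pos <;> linarith)
  set s := min 1 (-b / (2 * (|k| + 1))) with hs
  have h1 := h s hpos (min_le_left _ _)
  have h2 : s * (2 * (|k| + 1)) ≤ -b := (le_div_iff₀ (by positivity)).1 (min_le_right _ _)
  have h3 : 0 ≤ b + s * k := by
    have : 0 ≤ s * (b + s * k) := by linarith [h1, sq s, mul_add s b (s * k), mul_assoc s s k]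
    exact nonneg_of_mul_nonneg_right this hpos
  have h4 : s * k ≤ s * |k| := mul_le_mul_of_nonneg_left (le_abs_self k) hpos.le
  nlinarith

lemma eq_zero_of_forall_quadratic {b k : ℝ} (h : ∀ s : ℝ, 0 ≤ s * b + s ^ 2 * k) : b = 0 := by
  refine le_antisymm ?_ (nonneg_of_forall_quadratic fun s _ _ => h s)
  have := nonneg_of_forall_quadratic (b := -b) (k := k) fun s _ _ => by
    have := h (-s)
    linarith [neg_sq s]
  linarith

end Scalar

/-! ### The cone of positive semidefinite matrices -/

section PosSemidef

variable {n : Type*} [Fintype n]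

lemma isClosed_posSemidef : IsClosed {A : Matrix n n ℂ | A.PosSemidef} := by
  simp only [posSemidef_iff_dotProduct_mulVec, Set.ofPred_and, Set.ofPred_forall]
  refine IsClosed.inter (isClosed_eq ?_ continuous_id) (isClosed_iInter fun x => ?_)
  · exact continuous_id.matrix_conjTranspose
  · exact isClosed_le continuous_const
      (Continuous.dotProduct continuous_const (continuous_id.matrix_mulVec continuous_const))

open scoped MatrixOrder Matrix.Norms.L2Operator in
/-- A Hermitian matrix plus a large multiple of the identity is positive semidefinite. -/
lemma _root_.Matrix.IsHermitian.exists_posSemidef_add [DecidableEq n] {A : Matrix n n ℂ} (hA : A.IsHermitian) :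
    ∃ r : ℝ, (A + r • (1 : Matrix n n ℂ)).PosSemidef := by
  refine ⟨‖A‖, ?_⟩
  have h := IsSelfAdjoint.neg_algebraMap_norm_le_self (a := A) hA
  rw [Matrix.le_iff] at h
  simpa [Algebra.algebraMap_eq_smul_one] using h

lemma _root_.Matrix.PosSemidef.re_trace_nonneg {A : Matrix n n ℂ} (hA : A.PosSemidef) :
    0 ≤ A.trace.re := (Complex.le_def.1 hA.trace_nonneg).1

/-- The entries of a positive semidefinite matrix are bounded by twice its trace. -/
lemma _root_.Matrix.PosSemidef.norm_apply_le_trace [DecidableEq n] {A : Matrix n n ℂ} (hA : A.PosSemidef)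
    (i j : n) : ‖A i j‖ ≤ 2 * A.trace.re := by
  have hd : ∀ k, 0 ≤ (A k k).re := fun k => (Complex.le_def.1 hA.diag_nonneg).1
  have hle : ∀ k, (A k k).re ≤ A.trace.re := fun k => by
    rw [Matrix.trace, Complex.re_sum]
    exact Finset.single_le_sum (f := fun k => (A k k).re) (fun k _ => hd k) (Finset.mem_univ k)
  have hji : A j i = conj (A i j) := (hA.1.apply j i).symm
  -- Test with `e_i + z e_j`; the choices `z = ±1, ±I` then bound the real and imaginary parts of `A
  -- i j`.
  have key : ∀ z : ℂ, ‖z‖ = 1 → 0 ≤ (A i i).re + (A j j).re + 2 * (z * A i j).re := by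
    intro z hz
    have h := hA.re_dotProduct_nonneg (Pi.single i 1 + Pi.single j z)
    have hzz : z.re * z.re + z.im * z.im = 1 := by
      rw [← Complex.normSq_apply, Complex.normSq_eq_norm_sq, hz, one_pow]
    simp only [star_add, Matrix.mulVec_add, dotProduct_add, add_dotProduct, Pi.star_def] at h
    simp [Matrix.mulVec_single, Pi.single_apply, dotProduct] at h
    rw [Finset.sum_eq_single j (by intro b _ hb; simp [hb]) (by simp),
      Finset.sum_eq_single j (by intro b _ hb; simp [hb]) (by simp)] at h
    simp only [if_true, hji, Complex.conj_re, Complex.conj_im] at h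
    rw [Complex.mul_re]
    linear_combination h + (A j j).re * hzz
  have h1 := key 1 (by simp)
  have h2 := key (-1) (by simp)
  have h3 := key Complex.I (by simp)
  have h4 := key (-Complex.I) (by simp)
  simp at h1 h2 h3 h4
  refine (Complex.norm_le_abs_re_add_abs_im _).trans ?_
  have hre : |(A i j).re| ≤ A.trace.re := abs_le.2 ⟨by linarith [hle i, hle j], by linarith [hle i, hle j]⟩
  have him : |(A i j).im| ≤ A.trace.re := abs_le.2 ⟨by linarith [hle i, hle j], by linarith [hle i, hle j]⟩
  linarith

end PosSemidef

/-! ### Dual feasibility and conic duality -/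

section Certificates

lemma _root_.Matrix.IsHermitian.toBlocks₂₁_eq
    {A : Matrix (Fin N ⊕ Fin T) (Fin N ⊕ Fin T) ℂ} (hA : A.IsHermitian) :
    A.toBlocks₂₁ = A.toBlocks₁₂ᴴ := by
  ext i j
  exact (hA.apply _ _).symm

variable {Ω : Finset (Fin N)} [NeZero N]

/-- The linear form `A ↦ Re A₁₁ + Re tr A₂₂ + 2 c Re ⟨P_Ω(A₁₂), V⟩` on block matrices. -/
def matForm (c : ℝ) (V : Matrix Ω (Fin T) ℂ) :
    Matrix (Fin N ⊕ Fin T) (Fin N ⊕ Fin T) ℂ →ₗ[ℝ] ℝ where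
  toFun A := (A (Sum.inl 0) (Sum.inl 0)).re + A.toBlocks₂₂.trace.re
    + 2 * c * rinner V (restrictRowsLin Ω A.toBlocks₁₂)
  map_add' A B := by
    have h1 : (A + B).toBlocks₂₂ = A.toBlocks₂₂ + B.toBlocks₂₂ := rfl
    have h2 : (A + B).toBlocks₁₂ = A.toBlocks₁₂ + B.toBlocks₁₂ := rfl
    simp only [h1, h2, Matrix.add_apply, Complex.add_re, Matrix.trace_add, map_add]
    ring
  map_smul' r A := by
    have h1 : (r • A).toBlocks₂₂ = r • A.toBlocks₂₂ := rfl
    have h2 : (r • A).toBlocks₁₂ = r • A.toBlocks₁₂ := rfl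
    simp only [h1, h2, Matrix.smul_apply, Complex.smul_re, Matrix.trace_smul, map_smul,
      smul_eq_mul, RingHom.id_apply]
    ring

/-- The linear part of the goal-oriented Lagrangian, as a function of `(v, Z, W)`. -/
def goalForm (c : ℝ) (V : Matrix Ω (Fin T) ℂ) : Vars N T →ₗ[ℝ] ℝ := matForm c V ∘ₗ blockLin

lemma goalForm_apply (c : ℝ) (V : Matrix Ω (Fin T) ℂ) (x : Vars N T) :
    goalForm c V x = (x.1 0).re + x.2.2.trace.re + 2 * c * rinner V (restrictRowsLin Ω x.2.1) := by
  rw [← blockLin_inl_inl_zero x 0]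
  rfl

/-- The multipliers `V` for which the goal-oriented dual function is finite. -/
def IsDualFeasible (c : ℝ) (V : Matrix Ω (Fin T) ℂ) : Prop :=
  ∀ x : Vars N T, (blockLin x).PosSemidef → 0 ≤ goalForm c V x

/-- A Hermitian `Λ` certifies the dual feasibility of `V`. -/
structure IsCertificate (c : ℝ) (V : Matrix Ω (Fin T) ℂ)
    (Λ : Matrix (Fin N ⊕ Fin T) (Fin N ⊕ Fin T) ℂ) : Prop where
  isHermitian : Λ.IsHermitian
  nonneg : ∀ Ψ : Matrix (Fin N ⊕ Fin T) (Fin N ⊕ Fin T) ℂ, Ψ.PosSemidef → 0 ≤ rinner Λ Ψ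
  eq : ∀ x : Vars N T, rinner Λ (blockLin x) = goalForm c V x

/-- Testing the defining identity on `(0, Z, 0)` gives `2⟨Λ₁, Z⟩ = 2 c ⟨V, P_Ω(Z)⟩` in real parts.
This is the source of `P_Ω^Adj(V) = Λ₁ / c₁`. -/
lemma IsCertificate.toBlocks₁₂_eq {c : ℝ} {V : Matrix Ω (Fin T) ℂ}
    {Λ : Matrix (Fin N ⊕ Fin T) (Fin N ⊕ Fin T) ℂ} (h : IsCertificate c V Λ) :
    Λ.toBlocks₁₂ = c • restrictRowsAdjLin Ω V := by
  refine eq_of_forall_rinner_eq fun Z => ?_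
  have h1 := h.eq (0, Z, 0)
  rw [rinner_blockLin_offDiag Λ h.isHermitian.toBlocks₂₁_eq, goalForm_apply] at h1
  simp only [Pi.zero_apply, Complex.zero_re, Matrix.trace_zero] at h1
  rw [map_smul, LinearMap.smul_apply, rinner_restrictRowsAdjLin, smul_eq_mul]
  linarith

lemma IsCertificate.isDualFeasible {c : ℝ} {V : Matrix Ω (Fin T) ℂ}
    {Λ : Matrix (Fin N ⊕ Fin T) (Fin N ⊕ Fin T) ℂ} (h : IsCertificate c V Λ) :
    IsDualFeasible c V := fun x hx => h.eq x ▸ h.nonneg _ hx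

/-- Puts the identity, an interior point of the semidefinite cone, in the range of `blockLin`: the
Slater condition for the extension argument. -/
lemma blockLin_scalar (r : ℝ) :
    blockLin ((Pi.single 0 (r : ℂ), 0, r • 1) : Vars N T)
      = r • (1 : Matrix (Fin N ⊕ Fin T) (Fin N ⊕ Fin T) ℂ) := by
  ext (i | i) (l | l)
  · rcases lt_trichotomy i l with h | h | h
    · have h2 : (⟨l.val - i.val, lt_of_le_of_lt (Nat.sub_le _ _) l.isLt⟩ : Fin N) ≠ 0 := by
        rw [Ne, Fin.ext_iff]
        exact (Nat.sub_pos_of_lt h).ne'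
      change toeplitz (Pi.single 0 (r : ℂ)) i l = _
      rw [toeplitz_of_le _ h.le, Pi.single_eq_of_ne h2]
      simp [h.ne]
    · subst h
      rw [blockLin_diag]
      simp
    · have h2 : (⟨i.val - l.val, lt_of_le_of_lt (Nat.sub_le _ _) i.isLt⟩ : Fin N) ≠ 0 := by
        rw [Ne, Fin.ext_iff]
        exact (Nat.sub_pos_of_lt h).ne'
      change toeplitz (Pi.single 0 (r : ℂ)) i l = _
      rw [toeplitz_of_lt _ h, Pi.single_eq_of_ne h2]
      simp [h.ne']
  all_goals simp [blockLin, blockMat, Matrix.one_apply]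

/-- Conic duality: every dual feasible `V` has a certificate. -/
lemma IsDualFeasible.exists_isCertificate {c : ℝ} {V : Matrix Ω (Fin T) ℂ}
    (hV : IsDualFeasible c V) : ∃ Λ : Matrix (Fin N ⊕ Fin T) (Fin N ⊕ Fin T) ℂ,
      IsCertificate c V Λ := by
  -- The range of `blockLin` contains non-Hermitian matrices, so the cone is defined by the
  -- Hermitian part. It contains all skew-Hermitian matrices, on which a nonnegative functional must
  -- vanish.
  let s : PointedCone ℝ (Matrix (Fin N ⊕ Fin T) (Fin N ⊕ Fin T) ℂ) :=
    { carrier := {A | (A + Aᴴ).PosSemidef}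
      zero_mem' := by simpa using Matrix.PosSemidef.zero
      smul_mem' := fun r A hA => by
        have h : ((r : ℝ) • (A + Aᴴ)).PosSemidef := Matrix.PosSemidef.smul hA r.2
        have h2 : (r • A + (r • A)ᴴ) = (r : ℝ) • (A + Aᴴ) := by
          ext i j
          simp only [Matrix.add_apply, Matrix.smul_apply, Matrix.conjTranspose_apply, smul_add]
          change _ + conj ((r : ℝ) • A j i) = _ + (r : ℝ) • conj (A j i)
          rw [Complex.real_smul, Complex.real_smul, map_mul, Complex.conj_ofReal]
          rfl
        change (r • A + (r • A)ᴴ).PosSemidef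
        exact h2 ▸ h
      add_mem' := fun {A B} hA hB => by
        have h : (A + B + (A + B)ᴴ) = (A + Aᴴ) + (B + Bᴴ) := by
          rw [Matrix.conjTranspose_add]; abel
        change (A + B + (A + B)ᴴ).PosSemidef
        exact h ▸ Matrix.PosSemidef.add hA hB }
  have hs : ∀ A, A ∈ s ↔ (A + Aᴴ).PosSemidef := fun A => Iff.rfl
  -- Restricting `matForm`, which is defined on all matrices, makes `f` well defined without
  -- injectivity of `blockLin`.
  let f : Matrix (Fin N ⊕ Fin T) (Fin N ⊕ Fin T) ℂ →ₗ.[ℝ] ℝ :=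
    ⟨LinearMap.range (blockLin : Vars N T →ₗ[ℝ] _), (matForm c V).domRestrict _⟩
  have hf : ∀ x : f.domain, f x = matForm c V x := fun x => rfl
  obtain ⟨g, hgf, hgs⟩ := riesz_extension s f
    (by
      rintro ⟨_, x, rfl⟩ hx
      obtain ⟨y, hy, hy0, hy1, hy2⟩ := exists_blockLin_add_conjTranspose x
      rw [hs, hy] at hx
      have h1 := hV y hx
      rw [goalForm_apply, hy0, hy1, hy2, map_smul, map_smul, smul_eq_mul] at h1
      have h2 := goalForm_apply c V x
      rw [hf]
      change 0 ≤ goalForm c V x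
      linarith)
    (by
      intro A
      -- A multiple of the identity moves `A` into the cone; `r / 2` because taking `A + Aᴴ` doubles
      -- it.
      obtain ⟨r, hr⟩ := (Matrix.isHermitian_add_transpose_self A).exists_posSemidef_add
      refine ⟨⟨_, ((Pi.single 0 ((r / 2 : ℝ) : ℂ), 0, (r / 2) • 1) : Vars N T), rfl⟩, ?_⟩
      rw [hs]
      convert hr using 1
      simp only [blockLin_scalar, Matrix.conjTranspose_add, Matrix.conjTranspose_smul,
        Matrix.conjTranspose_one, star_trivial]
      have : r • (1 : Matrix (Fin N ⊕ Fin T) (Fin N ⊕ Fin T) ℂ) = (r / 2) • 1 + (r / 2) • 1 := by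
        rw [← add_smul, add_halves]
      rw [this]
      abel)
  obtain ⟨Λ, hΛ⟩ := exists_rinner_eq g
  -- Both `A - Aᴴ` and its negative lie in the cone, so `g` vanishes there and `Λ` is Hermitian.
  have hskew : ∀ A : Matrix (Fin N ⊕ Fin T) (Fin N ⊕ Fin T) ℂ, rinner Λ (A - Aᴴ) = 0 := by
    intro A
    have h1 := hgs (A - Aᴴ) (by simpa [hs] using Matrix.PosSemidef.zero)
    have h2 := hgs (-(A - Aᴴ)) (by simpa [hs] using Matrix.PosSemidef.zero)
    rw [map_neg] at h2
    rw [← hΛ]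
    linarith
  refine ⟨Λ, ?_, ?_, ?_⟩
  · refine eq_of_forall_rinner_eq fun A => ?_
    have := hskew A
    rw [map_sub] at this
    rw [rinner_conjTranspose]
    linarith
  · intro Ψ hΨ
    rw [← hΛ]
    refine hgs Ψ ?_
    rw [hs, hΨ.1]
    exact hΨ.add hΨ
  · intro x
    rw [← hΛ]
    exact hgf ⟨blockLin x, x, rfl⟩

end Certificates

/-! ### Existence of a KKT point and evaluation of the two dual functions -/

section Duality

lemma re_trace_nonneg_of_posSemidef {x : Vars N T} (hx : (blockLin x).PosSemidef) :
    0 ≤ x.2.2.trace.re :=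
  (hx.submatrix Sum.inr).re_trace_nonneg

lemma continuous_frobSq {m n : Type*} [Fintype m] [Fintype n] :
    Continuous (frobSq : Matrix m n ℂ → ℝ) := by
  unfold frobSq
  refine continuous_finsetSum _ fun i _ => continuous_finsetSum _ fun l _ => ?_
  exact ((continuous_id.matrix_elem i l).norm).pow 2

variable {Ω : Finset (Fin N)}

/-- The value of the dual functions at feasible multipliers. -/
def dualValue (γ : ℝ) (Y V : Matrix Ω (Fin T) ℂ) : ℝ := rinner Y V - 1 / (2 * γ) * frobSq V

/-- Completing the square in `Ys`; the minimizer is `Y - γ⁻¹ • V`. -/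
lemma quadratic_eq {γ : ℝ} (hγ : 0 < γ) (Y V Ys : Matrix Ω (Fin T) ℂ) :
    γ / 2 * frobSq (Y - Ys) + rinner V Ys
      = dualValue γ Y V + γ / 2 * frobSq (Y - Ys - γ⁻¹ • V) := by
  rw [frobSq_sub (Y - Ys), frobSq_smul, dualValue, map_smul, map_sub, LinearMap.sub_apply,
    rinner_comm V Ys, smul_eq_mul]
  field_simp
  ring

lemma dualValue_le {γ : ℝ} (hγ : 0 < γ) (Y V Ys : Matrix Ω (Fin T) ℂ) :
    dualValue γ Y V ≤ γ / 2 * frobSq (Y - Ys) + rinner V Ys := by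
  rw [quadratic_eq hγ]
  have := mul_nonneg (half_pos hγ).le (frobSq_nonneg (Y - Ys - γ⁻¹ • V))
  linarith

lemma dualValue_eq {γ : ℝ} (hγ : 0 < γ) (Y V : Matrix Ω (Fin T) ℂ) :
    γ / 2 * frobSq (Y - (Y - γ⁻¹ • V)) + rinner V (Y - γ⁻¹ • V) = dualValue γ Y V := by
  rw [quadratic_eq hγ, sub_sub_cancel, sub_self, frobSq_eq_zero.2 rfl, mul_zero, add_zero]

variable [NeZero N]

/-- The primal objective after eliminating `Ys`. -/
def primalObj (γ c : ℝ) (Y : Matrix Ω (Fin T) ℂ) (x : Vars N T) : ℝ :=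
  (x.1 0).re + x.2.2.trace.re + γ / 2 * frobSq (Y + (2 * c) • restrictRowsLin Ω x.2.1)

/-- The objective is quadratic along lines, so the expansion is exact. Its linear coefficient is
`goalForm` at the scaled residual, which is how the dual solution arises as a gradient. -/
lemma primalObj_add_smul (γ c : ℝ) (Y : Matrix Ω (Fin T) ℂ) (x d : Vars N T) (s : ℝ) :
    primalObj γ c Y (x + s • d) = primalObj γ c Y x
      + s * goalForm c (γ • (Y + (2 * c) • restrictRowsLin Ω x.2.1)) d
      + s ^ 2 * (γ * (2 * c ^ 2) * frobSq (restrictRowsLin Ω d.2.1)) := by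
  have h : Y + (2 * c) • restrictRowsLin Ω (x + s • d).2.1
      = (Y + (2 * c) • restrictRowsLin Ω x.2.1) + (s * (2 * c)) • restrictRowsLin Ω d.2.1 := by
    simp only [Prod.snd_add, Prod.fst_add, Prod.smul_snd, Prod.smul_fst, map_add, map_smul,
      smul_add, add_assoc, smul_smul]
    rw [mul_comm s]
  rw [primalObj, h, frobSq_add, goalForm_apply, primalObj, frobSq_smul]
  simp only [Prod.snd_add, Prod.fst_add, Prod.smul_snd, Prod.smul_fst, map_smul, Pi.add_apply,
    Pi.smul_apply, Complex.add_re, Complex.smul_re, Matrix.trace_add, Matrix.trace_smul,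
    LinearMap.smul_apply, smul_eq_mul]
  ring

lemma re_nonneg_of_posSemidef {x : Vars N T} (hx : (blockLin x).PosSemidef) :
    0 ≤ (x.1 0).re := by
  have h := (Complex.le_def.1 (hx.diag_nonneg (i := Sum.inl 0))).1
  rwa [blockLin_diag] at h

lemma continuous_primalObj (γ c : ℝ) (Y : Matrix Ω (Fin T) ℂ) :
    Continuous (primalObj (T := T) γ c Y) := by
  unfold primalObj
  have h1 : Continuous fun x : Vars N T => restrictRowsLin Ω x.2.1 :=
    (restrictRowsLin Ω).continuous_of_finiteDimensional.comp
      (continuous_fst.comp continuous_snd)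
  have h2 : Continuous fun x : Vars N T => x.2.2.trace :=
    (continuous_snd.comp continuous_snd).matrix_trace
  have h3 : Continuous fun x : Vars N T => x.1 0 := (continuous_apply 0).comp continuous_fst
  have h4 : Continuous fun x : Vars N T => (2 * c) • restrictRowsLin Ω x.2.1 :=
    h1.const_smul (2 * c)
  exact ((Complex.continuous_re.comp h3).add (Complex.continuous_re.comp h2)).add
    (continuous_const.mul (continuous_frobSq.comp (continuous_const.add h4)))

open scoped Matrix.Norms.Elementwise in
/-- The goal-oriented problem has a solution. -/
lemma exists_primal_minimizer {γ : ℝ} (hγ : 0 < γ) (c : ℝ) (Y : Matrix Ω (Fin T) ℂ) :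
    ∃ x : Vars N T, (blockLin x).PosSemidef ∧
      ∀ y : Vars N T, (blockLin y).PosSemidef → primalObj γ c Y x ≤ primalObj γ c Y y := by
  set m := primalObj γ c Y 0
  let K : Set (Vars N T) := {x | (blockLin x).PosSemidef} ∩ {x | primalObj γ c Y x ≤ m}
  have hblock : Continuous (blockLin : Vars N T →ₗ[ℝ] _) :=
    LinearMap.continuous_of_finiteDimensional _
  have hclosed : IsClosed K :=
    (isClosed_posSemidef.preimage hblock).inter
      (isClosed_le (continuous_primalObj γ c Y) continuous_const)
  have hpsd0 : (blockLin (0 : Vars N T)).PosSemidef := by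
    rw [map_zero]; exact Matrix.PosSemidef.zero
  -- The trace is `N * v₁ + tr W` with both real parts nonnegative and of sum at most `m`, hence at
  -- most `(N + 1) * m`; entries are at most twice the trace.
  have hbdd : K ⊆ Metric.closedBall 0 (2 * ((N + 1) * m)) := by
    rintro x ⟨hx, hxm⟩
    rw [mem_closedBall_zero_iff]
    have h0 := re_nonneg_of_posSemidef hx
    have h1 := re_trace_nonneg_of_posSemidef hx
    have h2 : (x.1 0).re + x.2.2.trace.re ≤ m := by
      have : primalObj γ c Y x ≤ m := hxm
      have h3 : 0 ≤ γ / 2 * frobSq (Y + (2 * c) • restrictRowsLin Ω x.2.1) :=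
        mul_nonneg (by linarith) (frobSq_nonneg _)
      unfold primalObj at this
      linarith
    have htr : (blockLin x).trace.re ≤ (N + 1) * m := by
      rw [trace_blockLin, Complex.add_re, Complex.mul_re, Complex.natCast_re,
        Complex.natCast_im, zero_mul, sub_zero]
      have : (0 : ℝ) ≤ N := Nat.cast_nonneg N
      nlinarith
    have hR : 0 ≤ 2 * ((N + 1) * m) := by
      have : 0 ≤ m := by linarith
      positivity
    have hent : ∀ i j, ‖blockLin x i j‖ ≤ 2 * ((N + 1) * m) := fun i j =>
      (hx.norm_apply_le_trace i j).trans (by linarith)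
    refine norm_prod_le_iff.2 ⟨(pi_norm_le_iff_of_nonneg hR).2 fun i => ?_,
      norm_prod_le_iff.2 ⟨(Matrix.norm_le_iff hR).2 fun i j => hent (Sum.inl i) (Sum.inr j),
        (Matrix.norm_le_iff hR).2 fun i j => hent (Sum.inr i) (Sum.inr j)⟩⟩
    rw [← blockLin_inl_inl_zero]
    exact hent _ _
  have : ProperSpace (Vars N T) := FiniteDimensional.proper ℝ _
  have hK : IsCompact K := (isCompact_closedBall _ _).of_isClosed_subset hclosed hbdd
  obtain ⟨x, hxK, hx⟩ := hK.exists_isMinOn ⟨0, hpsd0, le_refl m⟩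
    (continuous_primalObj γ c Y).continuousOn
  refine ⟨x, hxK.1, fun y hy => ?_⟩
  by_cases hym : primalObj γ c Y y ≤ m
  · exact hx ⟨hy, hym⟩
  · have : primalObj γ c Y x ≤ m := hxK.2
    linarith

/-- The optimality conditions of the primal problem at `x`, with gradient `V` and multiplier
`Λ`. -/
structure IsKKT (γ c : ℝ) (Y : Matrix Ω (Fin T) ℂ) (x : Vars N T) (V : Matrix Ω (Fin T) ℂ)
    (Λ : Matrix (Fin N ⊕ Fin T) (Fin N ⊕ Fin T) ℂ) : Prop where
  posSemidef : (blockLin x).PosSemidef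
  gradient : V = γ • (Y + (2 * c) • restrictRowsLin Ω x.2.1)
  isCertificate : IsCertificate c V Λ
  complementarity : goalForm c V x = 0

/-- First-order optimality at a minimizer over a convex cone: comparison with `0` and `2 • x` gives
complementarity, which turns the variational inequality into dual feasibility, and conic duality
supplies `Λ`. -/
lemma exists_isKKT {γ : ℝ} (hγ : 0 < γ) (c : ℝ) (Y : Matrix Ω (Fin T) ℂ) :
    ∃ (x : Vars N T) (V : Matrix Ω (Fin T) ℂ) (Λ : Matrix (Fin N ⊕ Fin T) (Fin N ⊕ Fin T) ℂ),
      IsKKT γ c Y x V Λ := by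
  obtain ⟨x, hx, hmin⟩ := exists_primal_minimizer (T := T) hγ c Y
  set V := γ • (Y + (2 * c) • restrictRowsLin Ω x.2.1) with hVdef
  have hvar : ∀ y : Vars N T, (blockLin y).PosSemidef → 0 ≤ goalForm c V (y - x) := by
    intro y hy
    refine nonneg_of_forall_quadratic
      (k := γ * (2 * c ^ 2) * frobSq (restrictRowsLin Ω (y - x).2.1)) fun s hs hs1 => ?_
    have hpsd : (blockLin (x + s • (y - x))).PosSemidef := by
      have h : blockLin (x + s • (y - x)) = (1 - s) • blockLin x + s • blockLin y := by
        rw [map_add, map_smul, map_sub, smul_sub, sub_smul, one_smul]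
        abel
      rw [h]
      exact (hx.smul (by linarith)).add (hy.smul hs.le)
    have h1 := hmin _ hpsd
    rw [primalObj_add_smul] at h1
    linarith
  have hzero : goalForm c V x = 0 := by
    have h1 := hvar 0 (by rw [map_zero]; exact Matrix.PosSemidef.zero)
    have h2 := hvar ((2 : ℝ) • x) (by rw [map_smul]; exact hx.smul zero_le_two)
    rw [map_sub, map_zero] at h1
    rw [map_sub, map_smul, smul_eq_mul] at h2
    linarith
  have hV : IsDualFeasible c V := fun y hy => by
    have := hvar y hy
    rw [map_sub, hzero] at this
    linarith
  obtain ⟨Λ, hΛ⟩ := hV.exists_isCertificate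
  exact ⟨x, V, Λ, hx, hVdef, hΛ, hzero⟩

/-- At a KKT point, `V` is the unique maximizer of `dualValue` among the feasible multipliers. -/
lemma IsKKT.dualValue_add_le {γ c : ℝ} (hγ : 0 < γ) {Y : Matrix Ω (Fin T) ℂ} {x : Vars N T}
    {V : Matrix Ω (Fin T) ℂ} {Λ : Matrix (Fin N ⊕ Fin T) (Fin N ⊕ Fin T) ℂ}
    (h : IsKKT γ c Y x V Λ) {V' : Matrix Ω (Fin T) ℂ} (hV' : IsDualFeasible c V') :
    dualValue γ Y V' + 1 / (2 * γ) * frobSq (V' - V) ≤ dualValue γ Y V := by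
  have h1 := hV' x h.posSemidef
  have h2 := h.complementarity
  rw [goalForm_apply] at h1 h2
  -- Eliminating `Y` shows that the two sides of the claim differ exactly by `goalForm c V' x`,
  -- which is nonnegative by feasibility of `V'`.
  have hY : Y = γ⁻¹ • V - (2 * c) • restrictRowsLin Ω x.2.1 := by
    rw [h.gradient, smul_smul, inv_mul_cancel₀ hγ.ne', one_smul, add_sub_cancel_right]
  have e : ∀ U, rinner Y U = γ⁻¹ * rinner V U - 2 * c * rinner U (restrictRowsLin Ω x.2.1) := by
    intro U
    conv_lhs => rw [hY]
    rw [map_sub, map_smul, map_smul, LinearMap.sub_apply, LinearMap.smul_apply,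
      LinearMap.smul_apply, smul_eq_mul, smul_eq_mul,
      rinner_comm (restrictRowsLin Ω x.2.1)]
  rw [dualValue, dualValue, e, e, frobSq_sub, rinner_self, rinner_comm V V']
  have e1 : γ⁻¹ = 2 * (1 / (2 * γ)) := by field_simp
  rw [e1]
  linarith

lemma IsKKT.eq_of_dualValue_le {γ c : ℝ} (hγ : 0 < γ) {Y : Matrix Ω (Fin T) ℂ} {x : Vars N T}
    {V : Matrix Ω (Fin T) ℂ} {Λ : Matrix (Fin N ⊕ Fin T) (Fin N ⊕ Fin T) ℂ}
    (h : IsKKT γ c Y x V Λ) {V' : Matrix Ω (Fin T) ℂ} (hV' : IsDualFeasible c V')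
    (hle : dualValue γ Y V ≤ dualValue γ Y V') : V' = V := by
  have h1 := h.dualValue_add_le hγ hV'
  have h2 : 0 < 1 / (2 * γ) := by positivity
  have h3 : frobSq (V' - V) = 0 := le_antisymm (by
    by_contra! h4
    have := mul_pos h2 h4
    linarith) (frobSq_nonneg _)
  exact sub_eq_zero.1 (frobSq_eq_zero.1 h3)

lemma IsKKT.dualValue_le {γ c : ℝ} (hγ : 0 < γ) {Y : Matrix Ω (Fin T) ℂ} {x : Vars N T}
    {V : Matrix Ω (Fin T) ℂ} {Λ : Matrix (Fin N ⊕ Fin T) (Fin N ⊕ Fin T) ℂ}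
    (h : IsKKT γ c Y x V Λ) {V' : Matrix Ω (Fin T) ℂ} (hV' : IsDualFeasible c V') :
    dualValue γ Y V' ≤ dualValue γ Y V := by
  have h1 := h.dualValue_add_le hγ hV'
  have h2 : 0 ≤ 1 / (2 * γ) * frobSq (V' - V) := mul_nonneg (by positivity) (frobSq_nonneg _)
  linarith

lemma goalLagrangian_eq (γ c : ℝ) (Y : Matrix Ω (Fin T) ℂ) (v : Fin N → ℂ)
    (Z : Matrix (Fin N) (Fin T) ℂ) (W : Matrix (Fin T) (Fin T) ℂ) (Ys V : Matrix Ω (Fin T) ℂ) :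
    goalLagrangian γ c Y v Z W Ys V
      = goalForm c V (v, Z, W) + (γ / 2 * frobSq (Y - Ys) + rinner V Ys) := by
  rw [goalLagrangian, goalObjective, goalForm_apply, re_cinner, rinner_comm, restrictRows_eq,
    map_sub, map_smul, smul_eq_mul]
  ring

/-- The Lagrangian separates into `goalForm` on the cone, with infimum 0 at the origin, and the
quadratic in `Ys`. -/
lemma goalDualFunction_eq {γ c : ℝ} (hγ : 0 < γ) (Y : Matrix Ω (Fin T) ℂ)
    {V : Matrix Ω (Fin T) ℂ} (hV : IsDualFeasible c V) :
    goalDualFunction γ c Y V = (dualValue γ Y V : EReal) := by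
  refine le_antisymm ?_ ?_
  · refine iInf_le_of_le 0 <| iInf_le_of_le 0 <| iInf_le_of_le 0 <|
      iInf_le_of_le (Y - γ⁻¹ • V) <| iInf_le_of_le ?_ ?_
    · rw [blockMat_eq, Prod.mk_zero_zero, Prod.mk_zero_zero, map_zero]
      exact Matrix.PosSemidef.zero
    · rw [goalLagrangian_eq, dualValue_eq hγ]
      have : goalForm c V ((0, 0, 0) : Vars N T) = 0 := map_zero _
      rw [this, zero_add]
  · refine le_iInf fun v => le_iInf fun Z => le_iInf fun W => le_iInf fun Ys => le_iInf fun h => ?_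
    rw [goalLagrangian_eq, EReal.coe_le_coe_iff]
    have h1 := hV (v, Z, W) h
    have h2 := GoalOriented.dualValue_le hγ Y V Ys
    linarith

/-- Along the ray `s • x` with `Ys = 0` the Lagrangian is affine in `s`, so a lower bound forces a
nonnegative slope. -/
lemma isDualFeasible_of_le_goalDualFunction {γ c m : ℝ} {Y V : Matrix Ω (Fin T) ℂ}
    (h : (m : EReal) ≤ goalDualFunction γ c Y V) : IsDualFeasible c V := by
  intro x hx
  refine nonneg_of_forall_le_add_mul (m := m) (a := γ / 2 * frobSq (Y - 0) + rinner V 0)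
    fun s hs => ?_
  have hpsd : (blockMat (s • x).1 (s • x).2.1 (s • x).2.2).PosSemidef := by
    change (blockLin (s • x)).PosSemidef
    rw [map_smul]
    exact hx.smul hs
  have h1 : (m : EReal) ≤ goalLagrangian γ c Y (s • x).1 (s • x).2.1 (s • x).2.2 0 V :=
    h.trans <| iInf_le_of_le _ <| iInf_le_of_le _ <| iInf_le_of_le _ <| iInf_le_of_le _ <|
      iInf_le_of_le hpsd le_rfl
  rw [EReal.coe_le_coe_iff, goalLagrangian_eq, Prod.mk.eta, map_smul, smul_eq_mul] at h1
  linarith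

lemma augLagrangian_eq (γ c ρ : ℝ) (Y : Matrix Ω (Fin T) ℂ) (v : Fin N → ℂ)
    (W : Matrix (Fin T) (Fin T) ℂ) (Z : Matrix (Fin N) (Fin T) ℂ)
    (Λ Ψ : Matrix (Fin N ⊕ Fin T) (Fin N ⊕ Fin T) ℂ) :
    augLagrangian γ c ρ Y v W Z Λ Ψ = primalObj γ c Y (v, Z, W)
      + rinner Λ (Ψ - blockLin (v, Z, W)) + ρ / 2 * frobSq (Ψ - blockLin (v, Z, W)) := rfl

/-- The certificate identity cancels `v` and `W`; what remains is the quadratic of `dualValue_le` at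
`Ys = -2 c P_Ω(Z)`, plus the pairing with `Ψ`. -/
lemma IsCertificate.augLagrangian_zero_eq {c : ℝ} {V : Matrix Ω (Fin T) ℂ}
    {Λ : Matrix (Fin N ⊕ Fin T) (Fin N ⊕ Fin T) ℂ} (h : IsCertificate c V Λ) (γ : ℝ)
    (Y : Matrix Ω (Fin T) ℂ) (v : Fin N → ℂ) (W : Matrix (Fin T) (Fin T) ℂ)
    (Z : Matrix (Fin N) (Fin T) ℂ) (Ψ : Matrix (Fin N ⊕ Fin T) (Fin N ⊕ Fin T) ℂ) :
    augLagrangian γ c 0 Y v W Z Λ Ψ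
      = (γ / 2 * frobSq (Y - -((2 * c) • restrictRowsLin Ω Z))
        + rinner V (-((2 * c) • restrictRowsLin Ω Z))) + rinner Λ Ψ := by
  rw [augLagrangian_eq, map_sub, h.eq, goalForm_apply, primalObj, sub_neg_eq_add, map_neg,
    map_smul, smul_eq_mul]
  ring

lemma IsCertificate.splitDualFunction_eq {γ c : ℝ} (hγ : 0 < γ) (hc : c ≠ 0)
    (Y : Matrix Ω (Fin T) ℂ) {V : Matrix Ω (Fin T) ℂ}
    {Λ : Matrix (Fin N ⊕ Fin T) (Fin N ⊕ Fin T) ℂ} (h : IsCertificate c V Λ) :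
    splitDualFunction γ c Y Λ = (dualValue γ Y V : EReal) := by
  refine le_antisymm ?_ ?_
  · refine iInf_le_of_le 0 <| iInf_le_of_le 0 <|
      -- Chosen so that `-2 c P_Ω(Z)` is the optimal `Y - γ⁻¹ • V`; this needs `c ≠ 0`.
      iInf_le_of_le (restrictRowsAdjLin Ω (-(2 * c)⁻¹ • (Y - γ⁻¹ • V))) <| iInf_le_of_le 0 <|
      iInf_le_of_le Matrix.PosSemidef.zero ?_
    have h2 : 2 * c ≠ 0 := mul_ne_zero two_ne_zero hc
    rw [h.augLagrangian_zero_eq, restrictRowsLin_restrictRowsAdjLin, smul_smul, mul_neg,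
      mul_inv_cancel₀ h2, neg_smul, one_smul, neg_neg, dualValue_eq hγ, map_zero, add_zero]
  · refine le_iInf fun v => le_iInf fun W => le_iInf fun Z => le_iInf fun Ψ => le_iInf fun hΨ => ?_
    rw [h.augLagrangian_zero_eq, EReal.coe_le_coe_iff]
    have h1 := h.nonneg Ψ hΨ
    have h2 := GoalOriented.dualValue_le hγ Y V (-((2 * c) • restrictRowsLin Ω Z))
    linarith

/-- Rays in `Ψ` give nonnegativity on the cone. Along directions with `P_Ω(Z) = 0` the Lagrangian is
affine, so its slope vanishes. On the rows in `Ω` the identity holds by the choice of `V`. -/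
lemma isCertificate_of_le_splitDualFunction {γ c m : ℝ} (hc : c ≠ 0) {Y : Matrix Ω (Fin T) ℂ}
    {Λ : Matrix (Fin N ⊕ Fin T) (Fin N ⊕ Fin T) ℂ} (hΛ : Λ.IsHermitian)
    (h : (m : EReal) ≤ splitDualFunction γ c Y Λ) :
    IsCertificate c (c⁻¹ • restrictRowsLin Ω Λ.toBlocks₁₂) Λ := by
  have hle : ∀ (x : Vars N T) (Ψ : Matrix (Fin N ⊕ Fin T) (Fin N ⊕ Fin T) ℂ), Ψ.PosSemidef →
      m ≤ primalObj γ c Y x + rinner Λ (Ψ - blockLin x) := by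
    intro x Ψ hΨ
    have h1 : (m : EReal) ≤ augLagrangian γ c 0 Y x.1 x.2.2 x.2.1 Λ Ψ :=
      h.trans <| iInf_le_of_le _ <| iInf_le_of_le _ <| iInf_le_of_le _ <| iInf_le_of_le _ <|
        iInf_le_of_le hΨ le_rfl
    rw [EReal.coe_le_coe_iff, augLagrangian_eq] at h1
    simpa using h1
  have hker : ∀ d : Vars N T, restrictRowsLin Ω d.2.1 = 0 →
      (d.1 0).re + d.2.2.trace.re - rinner Λ (blockLin d) = 0 := by
    intro d hd
    refine eq_zero_of_forall_le_add_mul (m := m) (a := primalObj γ c Y (0 : Vars N T)) fun s => ?_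
    have h1 := hle (0 + s • d) 0 Matrix.PosSemidef.zero
    rw [primalObj_add_smul, hd, goalForm_apply, hd, frobSq_eq_zero.2 rfl, zero_add, map_sub,
      map_zero, map_smul, map_smul, map_zero, smul_eq_mul] at h1
    linarith
  refine ⟨hΛ, fun Ψ hΨ => ?_, fun x => ?_⟩
  · refine nonneg_of_forall_le_add_mul (m := m) (a := primalObj γ c Y (0 : Vars N T)) fun s hs => ?_
    have h1 := hle 0 (s • Ψ) (hΨ.smul hs)
    rwa [map_zero, sub_zero, map_smul, smul_eq_mul] at h1
  · set Z' := restrictRowsAdjLin Ω (restrictRowsLin Ω x.2.1) with hZ'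
    have hx : x = (x.1, x.2.1 - Z', x.2.2) + (0, Z', 0) := by
      simp
    have h1 := hker (x.1, x.2.1 - Z', x.2.2) (by
      rw [map_sub, hZ', restrictRowsLin_restrictRowsAdjLin, sub_self])
    conv_lhs => rw [hx]
    rw [map_add, map_add, rinner_blockLin_offDiag Λ hΛ.toBlocks₂₁_eq, goalForm_apply, map_smul,
      LinearMap.smul_apply, smul_eq_mul, rinner_comm _ Z', hZ', rinner_restrictRowsAdjLin,
      rinner_comm (restrictRowsLin Ω x.2.1), ← hZ']
    dsimp only at h1
    have h2 : 2 * c * (c⁻¹ * rinner (restrictRowsLin Ω Λ.toBlocks₁₂) (restrictRowsLin Ω x.2.1))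
        = 2 * rinner (restrictRowsLin Ω Λ.toBlocks₁₂) (restrictRowsLin Ω x.2.1) := by
      field_simp
    linarith

end Duality

/-! ### Convergence of ADMM by energy descent -/

section ADMM

lemma tendsto_zero_of_energy_descent {E D : ℕ → ℝ} (hE : ∀ n, 0 ≤ E n) (hD : ∀ n, 0 ≤ D n)
    (h : ∀ n, E (n + 1) + D n ≤ E n) : Tendsto D atTop (𝓝 0) := by
  have hanti : Antitone E := antitone_nat_of_succ_le fun n => by linarith [h n, hD n]
  have hlim := tendsto_atTop_ciInf hanti ⟨0, by rintro _ ⟨n, rfl⟩; exact hE n⟩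
  have hdiff : Tendsto (fun n => E n - E (n + 1)) atTop (𝓝 0) := by
    simpa using hlim.sub ((tendsto_add_atTop_iff_nat 1).2 hlim)
  exact squeeze_zero hD (fun n => by linarith [h n]) hdiff

variable {Ω : Finset (Fin N)} [NeZero N] {γ c ρ : ℝ} {Y : Matrix Ω (Fin T) ℂ}
  {v : ℕ → Fin N → ℂ} {W : ℕ → Matrix (Fin T) (Fin T) ℂ} {Z : ℕ → Matrix (Fin N) (Fin T) ℂ}
  {Ψ Λ : ℕ → Matrix (Fin N ⊕ Fin T) (Fin N ⊕ Fin T) ℂ}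

lemma IsADMMRun.step_Λ' (h : IsADMMRun γ c ρ Y v W Z Ψ Λ) (t : ℕ) :
    Λ (t + 1) = Λ t + ρ • (Ψ (t + 1) - blockLin (v (t + 1), Z (t + 1), W (t + 1))) :=
  h.step_Λ t

/-- First-order optimality of the `(v, W, Z)` update. -/
lemma IsADMMRun.goalForm_eq (h : IsADMMRun γ c ρ Y v W Z Ψ Λ) (t : ℕ) (d : Vars N T) :
    goalForm c (γ • (Y + (2 * c) • restrictRowsLin Ω (Z (t + 1)))) d
      = rinner (Λ (t + 1) + ρ • (Ψ t - Ψ (t + 1))) (blockLin d) := by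
  set x : Vars N T := (v (t + 1), Z (t + 1), W (t + 1)) with hx
  -- The update was minimized with `Λ t` and `Ψ t`; the multiplier step rewrites its stationarity in
  -- terms of `Λ (t + 1)`.
  have hΛ : Λ (t + 1) + ρ • (Ψ t - Ψ (t + 1)) = Λ t + ρ • (Ψ t - blockLin x) := by
    rw [h.step_Λ' t, add_assoc, ← smul_add, add_comm (Ψ (t + 1) - _), sub_add_sub_cancel]
  have key := eq_zero_of_forall_quadratic
    (b := goalForm c (γ • (Y + (2 * c) • restrictRowsLin Ω (Z (t + 1)))) d
      - rinner (Λ t + ρ • (Ψ t - blockLin x)) (blockLin d))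
    (k := γ * (2 * c ^ 2) * frobSq (restrictRowsLin Ω d.2.1) + ρ / 2 * frobSq (blockLin d))
    fun s => by
      have h1 := h.step_vWZ t (x + s • d).1 (x + s • d).2.2 (x + s • d).2.1
      rw [augLagrangian_eq, augLagrangian_eq, ← hx, Prod.mk.eta,
        primalObj_add_smul, map_add, map_smul, ← sub_sub, frobSq_sub (Ψ t - blockLin x),
        map_sub (rinner (Λ t)) (Ψ t - blockLin x), map_smul, map_smul, frobSq_smul,
        smul_eq_mul, smul_eq_mul] at h1
      rw [map_add rinner, LinearMap.add_apply, map_smul rinner, LinearMap.smul_apply, smul_eq_mul]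
      change _ ≤ primalObj γ c Y x
        + s * goalForm c (γ • (Y + (2 * c) • restrictRowsLin Ω (Z (t + 1)))) d + _ + _ + _ at h1
      linarith
  rw [hΛ]
  linarith

/-- First-order optimality of the `Ψ` update. -/
lemma IsADMMRun.rinner_sub_nonneg (h : IsADMMRun γ c ρ Y v W Z Ψ Λ) (t : ℕ)
    {Ψ' : Matrix (Fin N ⊕ Fin T) (Fin N ⊕ Fin T) ℂ} (hΨ' : Ψ'.PosSemidef) :
    0 ≤ rinner (Λ (t + 1)) (Ψ' - Ψ (t + 1)) := by
  set x : Vars N T := (v (t + 1), Z (t + 1), W (t + 1)) with hx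
  refine nonneg_of_forall_quadratic (k := ρ / 2 * frobSq (Ψ' - Ψ (t + 1))) fun s hs hs1 => ?_
  have hpsd : (Ψ (t + 1) + s • (Ψ' - Ψ (t + 1))).PosSemidef := by
    have e : Ψ (t + 1) + s • (Ψ' - Ψ (t + 1)) = (1 - s) • Ψ (t + 1) + s • Ψ' := by
      rw [smul_sub, sub_smul, one_smul]
      abel
    rw [e]
    exact ((h.step_Ψ_posSemidef t).smul (by linarith)).add (hΨ'.smul hs.le)
  have h1 := h.step_Ψ t _ hpsd
  rw [augLagrangian_eq, augLagrangian_eq, ← hx, add_sub_right_comm, map_add,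
    frobSq_add (Ψ (t + 1) - blockLin x), frobSq_smul, map_smul, map_smul, smul_eq_mul,
    smul_eq_mul] at h1
  rw [h.step_Λ' t, ← hx, map_add rinner, LinearMap.add_apply, map_smul rinner,
    LinearMap.smul_apply, smul_eq_mul]
  linarith

/-- The part of Hermitian symmetry that is automatic: the off-diagonal blocks of `blockMat` are `Z`
and `Zᴴ`, whatever `v` and `W` are. -/
lemma IsADMMRun.toBlocks₂₁_eq (h : IsADMMRun γ c ρ Y v W Z Ψ Λ) (t : ℕ) :
    (Λ t).toBlocks₂₁ = (Λ t).toBlocks₁₂ᴴ := by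
  induction t with
  | zero => exact h.init_Λ.toBlocks₂₁_eq
  | succ t ih =>
    rw [h.step_Λ' t]
    have h1 := (h.step_Ψ_posSemidef t).1.toBlocks₂₁_eq
    change (Λ t).toBlocks₂₁ + ρ • ((Ψ (t + 1)).toBlocks₂₁ - (Z (t + 1))ᴴ)
      = ((Λ t).toBlocks₁₂ + ρ • ((Ψ (t + 1)).toBlocks₁₂ - Z (t + 1)))ᴴ
    rw [ih, h1, conjTranspose_add, conjTranspose_smul, conjTranspose_sub, star_trivial]

lemma IsADMMRun.isHermitian_Ψ (h : IsADMMRun γ c ρ Y v W Z Ψ Λ) (t : ℕ) :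
    (Ψ t).IsHermitian := by
  cases t with
  | zero => exact h.init_Ψ
  | succ t => exact (h.step_Ψ_posSemidef t).1

/-- Stationarity of the `(v, W, Z)` update in the direction `(0, D, 0)`. The diagonal blocks of `Λ`
drop out. -/
lemma IsADMMRun.toBlocks₁₂_eq (h : IsADMMRun γ c ρ Y v W Z Ψ Λ) (t : ℕ) :
    (Λ (t + 1)).toBlocks₁₂
      = c • restrictRowsAdjLin Ω (γ • (Y + (2 * c) • restrictRowsLin Ω (Z (t + 1))))
        + ρ • (Ψ (t + 1) - Ψ t).toBlocks₁₂ := by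
  set A := Λ (t + 1) + ρ • (Ψ t - Ψ (t + 1)) with hA
  have hA21 : A.toBlocks₂₁ = A.toBlocks₁₂ᴴ := by
    change (Λ (t + 1)).toBlocks₂₁ + ρ • ((Ψ t).toBlocks₂₁ - (Ψ (t + 1)).toBlocks₂₁)
      = ((Λ (t + 1)).toBlocks₁₂ + ρ • ((Ψ t).toBlocks₁₂ - (Ψ (t + 1)).toBlocks₁₂))ᴴ
    rw [h.toBlocks₂₁_eq, (h.isHermitian_Ψ t).toBlocks₂₁_eq,
      (h.isHermitian_Ψ (t + 1)).toBlocks₂₁_eq, conjTranspose_add, conjTranspose_smul,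
      conjTranspose_sub, star_trivial]
  have hA12 : A.toBlocks₁₂
      = c • restrictRowsAdjLin Ω (γ • (Y + (2 * c) • restrictRowsLin Ω (Z (t + 1)))) := by
    refine eq_of_forall_rinner_eq fun D => ?_
    have h1 := h.goalForm_eq t (0, D, 0)
    rw [← hA, rinner_blockLin_offDiag A hA21, goalForm_apply] at h1
    simp only [Pi.zero_apply, Complex.zero_re, Matrix.trace_zero] at h1
    rw [map_smul rinner, LinearMap.smul_apply, rinner_restrictRowsAdjLin, smul_eq_mul]
    linarith
  rw [← hA12]
  change _ = (Λ (t + 1)).toBlocks₁₂ + ρ • ((Ψ t).toBlocks₁₂ - (Ψ (t + 1)).toBlocks₁₂)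
    + ρ • ((Ψ (t + 1)).toBlocks₁₂ - (Ψ t).toBlocks₁₂)
  rw [add_assoc, ← smul_add, sub_add_sub_cancel, sub_self, smul_zero, add_zero]

/-- The energy of an ADMM run relative to a KKT point decreases. -/
lemma IsADMMRun.energy_descent (h : IsADMMRun γ c ρ Y v W Z Ψ Λ) (hρ : 0 < ρ)
    {x : Vars N T} {V : Matrix Ω (Fin T) ℂ} {Λs : Matrix (Fin N ⊕ Fin T) (Fin N ⊕ Fin T) ℂ}
    (hk : IsKKT γ c Y x V Λs) (t : ℕ) :
    (1 / (2 * ρ) * frobSq (Λ (t + 2) - Λs) + ρ / 2 * frobSq (Ψ (t + 2) - blockLin x))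
      + (4 * c ^ 2 * γ * frobSq (restrictRowsLin Ω (Z (t + 2) - x.2.1))
        + ρ / 2 * frobSq (Ψ (t + 2) - Ψ (t + 1)))
      ≤ 1 / (2 * ρ) * frobSq (Λ (t + 1) - Λs) + ρ / 2 * frobSq (Ψ (t + 1) - blockLin x) := by
  set y : Vars N T := (v (t + 2), Z (t + 2), W (t + 2)) with hy
  set a := Λ (t + 2) - Λs with ha
  set p := Λ (t + 2) - Λ (t + 1) with hp
  set b := Ψ (t + 2) - blockLin x with hb
  set q := Ψ (t + 2) - Ψ (t + 1) with hq
  have e1 : Λ (t + 1) - Λs = a - p := by rw [ha, hp]; abel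
  have e2 : Ψ (t + 1) - blockLin x = b - q := by rw [hb, hq]; abel
  -- Monotonicity of the normal cone of the semidefinite cone, between the new iterate and the KKT
  -- point; `hpq` is the same between consecutive iterates. Two `Ψ` updates are involved, so the
  -- descent starts at index 1.
  have hab : rinner a b ≤ 0 := by
    have h1 := h.rinner_sub_nonneg (t + 1) hk.posSemidef
    have h2 := hk.isCertificate.nonneg _ (h.step_Ψ_posSemidef (t + 1))
    have h3 := (hk.isCertificate.eq x).trans hk.complementarity
    rw [map_sub] at h1
    rw [ha, hb, map_sub rinner, LinearMap.sub_apply, map_sub, map_sub, h3]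
    linarith
  have hpq : rinner p q ≤ 0 := by
    have h1 := h.rinner_sub_nonneg (t + 1) (h.step_Ψ_posSemidef t)
    have h2 := h.rinner_sub_nonneg t (h.step_Ψ_posSemidef (t + 1))
    rw [map_sub] at h1 h2
    rw [hp, hq, map_sub rinner, LinearMap.sub_apply, map_sub, map_sub]
    linarith
  have hB : blockLin (y - x) = b - ρ⁻¹ • p := by
    have h1 := h.step_Λ' (t + 1)
    rw [← hy] at h1
    have h2 : ρ⁻¹ • p = Ψ (t + 2) - blockLin y := by
      rw [hp, h1, add_sub_cancel_left, smul_smul, inv_mul_cancel₀ hρ.ne', one_smul]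
    rw [h2, hb, map_sub]
    abel
  -- Subtract the stationarity conditions of the iterate and of the KKT point and test with `y - x`.
  -- Expanding the right side yields the cross terms of the energy difference plus `rinner a b +
  -- rinner p q`.
  have hmain : 4 * c ^ 2 * γ * frobSq (restrictRowsLin Ω (Z (t + 2) - x.2.1))
      = rinner (a - ρ • q) (b - ρ⁻¹ • p) := by
    have h1 := h.goalForm_eq (t + 1) (y - x)
    have h2 := hk.isCertificate.eq (y - x)
    rw [hk.gradient] at h2
    have h3 : a - ρ • q = (Λ (t + 2) + ρ • (Ψ (t + 1) - Ψ (t + 2))) - Λs := by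
      rw [ha, hq, ← neg_sub (Ψ (t + 2)), smul_neg]
      abel
    rw [← hB, h3, map_sub rinner, LinearMap.sub_apply, h2, ← h1, goalForm_apply, goalForm_apply]
    have h4 : (y - x).2.1 = Z (t + 2) - x.2.1 := rfl
    rw [h4, ← rinner_self]
    simp only [map_smul, map_add, map_sub, LinearMap.smul_apply, LinearMap.add_apply,
      LinearMap.sub_apply, smul_eq_mul]
    ring
  rw [e1, e2, hmain, frobSq_sub a p, frobSq_sub b q]
  simp only [map_sub, map_smul, LinearMap.sub_apply, LinearMap.smul_apply, smul_eq_mul]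
  rw [rinner_comm q b, rinner_comm q p]
  have hpn : 0 ≤ 1 / (2 * ρ) * frobSq p := mul_nonneg (by positivity) (frobSq_nonneg _)
  have e3 : ρ⁻¹ = 2 * (1 / (2 * ρ)) := by field_simp
  have e5 : ρ⁻¹ * (ρ * rinner p q) = rinner p q := by
    rw [← mul_assoc, inv_mul_cancel₀ hρ.ne', one_mul]
  rw [mul_sub ρ⁻¹, e5, e3]
  linarith

/-- Both terms dissipated by the energy tend to zero, and `heq` exhibits the error of `c⁻¹ • Λ₁` as
a linear image of them. -/
lemma IsADMMRun.tendsto (h : IsADMMRun γ c ρ Y v W Z Ψ Λ) (hγ : 0 < γ) (hc : c ≠ 0) (hρ : 0 < ρ)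
    {x : Vars N T} {V : Matrix Ω (Fin T) ℂ} {Λs : Matrix (Fin N ⊕ Fin T) (Fin N ⊕ Fin T) ℂ}
    (hk : IsKKT γ c Y x V Λs) :
    Tendsto (fun t => c⁻¹ • (Λ t).toBlocks₁₂) atTop (𝓝 (restrictRowsAdj Ω V)) := by
  have hk0 : 0 < 4 * c ^ 2 * γ := by positivity
  have hZ0 : ∀ t, 0 ≤ 4 * c ^ 2 * γ * frobSq (restrictRowsLin Ω (Z (t + 2) - x.2.1)) :=
    fun t => mul_nonneg hk0.le (frobSq_nonneg _)
  have hΨ0 : ∀ t, 0 ≤ ρ / 2 * frobSq (Ψ (t + 2) - Ψ (t + 1)) :=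
    fun t => mul_nonneg (half_pos hρ).le (frobSq_nonneg _)
  have hD := tendsto_zero_of_energy_descent
    (E := fun t => 1 / (2 * ρ) * frobSq (Λ (t + 1) - Λs)
      + ρ / 2 * frobSq (Ψ (t + 1) - blockLin x))
    (fun t => add_nonneg (mul_nonneg (by positivity) (frobSq_nonneg _))
      (mul_nonneg (half_pos hρ).le (frobSq_nonneg _)))
    (fun t => add_nonneg (hZ0 t) (hΨ0 t)) (fun t => h.energy_descent hρ hk t)
  have hZ : Tendsto (fun t => restrictRowsLin Ω (Z (t + 2) - x.2.1)) atTop (𝓝 0) := by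
    refine tendsto_zero_of_frobSq ?_
    have h1 := (squeeze_zero hZ0 (fun t => le_add_of_nonneg_right (hΨ0 t)) hD).const_mul
      (4 * c ^ 2 * γ)⁻¹
    simpa only [inv_mul_cancel_left₀ hk0.ne', mul_zero] using h1
  have hΨ : Tendsto (fun t => Ψ (t + 2) - Ψ (t + 1)) atTop (𝓝 0) := by
    refine tendsto_zero_of_frobSq ?_
    have h1 := (squeeze_zero hΨ0 (fun t => le_add_of_nonneg_left (hZ0 t)) hD).const_mul (ρ / 2)⁻¹
    simpa only [inv_mul_cancel_left₀ (half_pos hρ).ne', mul_zero] using h1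
  have hΨ12 : Tendsto (fun t => (Ψ (t + 2) - Ψ (t + 1)).toBlocks₁₂) atTop (𝓝 0) := by
    have hcont : Continuous fun A : Matrix (Fin N ⊕ Fin T) (Fin N ⊕ Fin T) ℂ => A.toBlocks₁₂ :=
      continuous_id.matrix_submatrix Sum.inl Sum.inr
    exact (hcont.tendsto 0).comp hΨ
  have hPZ : Tendsto (fun t => restrictRowsAdjLin Ω (restrictRowsLin Ω (Z (t + 2) - x.2.1)))
      atTop (𝓝 0) := by
    have hcont : Continuous (restrictRowsAdjLin (T := T) Ω) :=
      LinearMap.continuous_of_finiteDimensional _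
    have h1 := (hcont.tendsto 0).comp hZ
    rwa [map_zero] at h1
  rw [← tendsto_add_atTop_iff_nat 2, restrictRowsAdj_eq]
  have heq : ∀ t, c⁻¹ • (Λ (t + 2)).toBlocks₁₂ = restrictRowsAdjLin Ω V
      + (γ * (2 * c)) • restrictRowsAdjLin Ω (restrictRowsLin Ω (Z (t + 2) - x.2.1))
      + (c⁻¹ * ρ) • (Ψ (t + 2) - Ψ (t + 1)).toBlocks₁₂ := by
    intro t
    rw [h.toBlocks₁₂_eq (t + 1), smul_add, smul_smul, smul_smul, inv_mul_cancel₀ hc, one_smul,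
      hk.gradient]
    congr 1
    simp only [map_smul, map_add, map_sub, smul_add, smul_sub, smul_smul]
    abel
  simp only [heq]
  have hlim := (tendsto_const_nhds (x := restrictRowsAdjLin Ω V)).add (hPZ.const_smul (γ * (2 * c)))
    |>.add (hΨ12.const_smul (c⁻¹ * ρ))
  simpa only [smul_zero, add_zero] using hlim

end ADMM

lemma c1_pos {K : ℕ} [NeZero N] (φ : Fin K → EuclideanSpace ℂ (Fin T)) (hφ : ∃ k, φ k ≠ 0) :
    0 < c1 N φ := by
  obtain ⟨k, hk⟩ := hφ
  have h1 : 0 < ⨆ k, ‖φ k‖ :=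
    (norm_pos_iff.2 hk).trans_le (le_ciSup (Set.finite_range fun k => ‖φ k‖).bddAbove k)
  exact div_pos h1 (Real.sqrt_pos.2 (Nat.cast_pos.2 (NeZero.pos N)))

/-! ### Characterization of dual solutions and optimal multipliers by a KKT point -/

section Optimality

variable {Ω : Finset (Fin N)} [NeZero N] {γ c : ℝ} {Y : Matrix Ω (Fin T) ℂ} {x : Vars N T}
  {V : Matrix Ω (Fin T) ℂ} {Λ : Matrix (Fin N ⊕ Fin T) (Fin N ⊕ Fin T) ℂ}

lemma IsKKT.isDualSolution_iff (h : IsKKT γ c Y x V Λ) (hγ : 0 < γ) (V' : Matrix Ω (Fin T) ℂ) :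
    IsDualSolution γ c Y V' ↔ V' = V := by
  have hV := h.isCertificate.isDualFeasible
  constructor
  · intro hV'
    have h1 := hV' V
    rw [goalDualFunction_eq hγ Y hV] at h1
    have h2 := isDualFeasible_of_le_goalDualFunction h1
    rw [goalDualFunction_eq hγ Y h2, EReal.coe_le_coe_iff] at h1
    exact h.eq_of_dualValue_le hγ h2 h1
  · rintro rfl V'
    -- Comparing with reals `m` below the dual value of the competitor disposes of `⊥` vacuously;
    -- any such `m` makes the competitor feasible.
    refine EReal.ge_of_forall_gt_iff_ge.1 fun m hm => ?_
    have h2 := isDualFeasible_of_le_goalDualFunction hm.le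
    rw [goalDualFunction_eq hγ Y h2] at hm
    rw [goalDualFunction_eq hγ Y hV]
    exact hm.le.trans (EReal.coe_le_coe_iff.2 (h.dualValue_le hγ h2))

lemma IsKKT.isOptimalMultiplier (h : IsKKT γ c Y x V Λ) (hγ : 0 < γ) (hc : c ≠ 0) :
    IsOptimalMultiplier γ c Y Λ := by
  refine ⟨h.isCertificate.isHermitian, fun Λ' hΛ' => ?_⟩
  refine EReal.ge_of_forall_gt_iff_ge.1 fun m hm => ?_
  have h2 := isCertificate_of_le_splitDualFunction hc hΛ' hm.le
  rw [h2.splitDualFunction_eq hγ hc] at hm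
  rw [h.isCertificate.splitDualFunction_eq hγ hc]
  exact hm.le.trans (EReal.coe_le_coe_iff.2 (h.dualValue_le hγ h2.isDualFeasible))

lemma IsKKT.restrictRowsAdj_eq (h : IsKKT γ c Y x V Λ) (hγ : 0 < γ) (hc : c ≠ 0)
    {Λ' : Matrix (Fin N ⊕ Fin T) (Fin N ⊕ Fin T) ℂ} (hΛ' : IsOptimalMultiplier γ c Y Λ') :
    restrictRowsAdj Ω V = c⁻¹ • Λ'.toBlocks₁₂ := by
  have h1 := hΛ'.2 Λ h.isCertificate.isHermitian
  rw [h.isCertificate.splitDualFunction_eq hγ hc] at h1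
  have h2 := isCertificate_of_le_splitDualFunction hc hΛ'.1 h1
  rw [h2.splitDualFunction_eq hγ hc, EReal.coe_le_coe_iff] at h1
  have h3 := h.eq_of_dualValue_le hγ h2.isDualFeasible h1
  rw [h2.toBlocks₁₂_eq, h3, smul_smul, inv_mul_cancel₀ hc, one_smul]
  rfl

end Optimality

end GoalOriented

end

theorem mainTheorem4 {N T K : ℕ} [NeZero N]
    (Ω : Finset (Fin N)) (Y : Matrix Ω (Fin T) ℂ)
    (φ : Fin K → EuclideanSpace ℂ (Fin T)) (hφ : ∃ k, φ k ≠ 0)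
    (γ : ℝ) (hγ : 0 < γ) :
    (∃! V : Matrix Ω (Fin T) ℂ, GoalOriented.IsDualSolution γ (GoalOriented.c1 N φ) Y V) ∧
    (∃ Λ : Matrix (Fin N ⊕ Fin T) (Fin N ⊕ Fin T) ℂ,
      GoalOriented.IsOptimalMultiplier γ (GoalOriented.c1 N φ) Y Λ) ∧
    ∀ V : Matrix Ω (Fin T) ℂ, GoalOriented.IsDualSolution γ (GoalOriented.c1 N φ) Y V →
      (∀ Λ : Matrix (Fin N ⊕ Fin T) (Fin N ⊕ Fin T) ℂ,
        GoalOriented.IsOptimalMultiplier γ (GoalOriented.c1 N φ) Y Λ →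
          GoalOriented.restrictRowsAdj Ω V = (GoalOriented.c1 N φ)⁻¹ • Λ.toBlocks₁₂) ∧
      (∀ ρ : ℝ, 0 < ρ →
        ∀ (v : ℕ → Fin N → ℂ) (W : ℕ → Matrix (Fin T) (Fin T) ℂ)
          (Z : ℕ → Matrix (Fin N) (Fin T) ℂ)
          (Ψ Λ : ℕ → Matrix (Fin N ⊕ Fin T) (Fin N ⊕ Fin T) ℂ),
          GoalOriented.IsADMMRun γ (GoalOriented.c1 N φ) ρ Y v W Z Ψ Λ →
            Tendsto (fun t => (GoalOriented.c1 N φ)⁻¹ • (Λ t).toBlocks₁₂) atTop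
              (𝓝 (GoalOriented.restrictRowsAdj Ω V))) := by
  have hc := (GoalOriented.c1_pos (N := N) φ hφ).ne'
  obtain ⟨x, V₀, Λ₀, h⟩ := GoalOriented.exists_isKKT (T := T) hγ (GoalOriented.c1 N φ) Y
  refine ⟨⟨V₀, (h.isDualSolution_iff hγ V₀).2 rfl, fun V hV => (h.isDualSolution_iff hγ V).1 hV⟩,
    ⟨Λ₀, h.isOptimalMultiplier hγ hc⟩, fun V hV => ?_⟩
  obtain rfl := (h.isDualSolution_iff hγ V).1 hV
  exact ⟨fun Λ hΛ => h.restrictRowsAdj_eq hγ hc hΛ,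
    fun ρ hρ v W Z Ψ Λ hrun => hrun.tendsto hγ hc hρ h⟩
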